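/- Let $\gamma_0,\gamma_1\in\mathbb{R}$ with $\gamma_0,\gamma_1\neq 0$ and $|\gamma_0|\neq|\gamma_1|$. Let $\psi_t(x)\in\mathbb{C}$ ($t\ge 0$, $x\in\mathbb{Z}$) be the amplitude of the continuous-time quantum walk on $\mathbb{Z}$ that starts at the origin, i.e. $\psi_0(0)=1$, $\psi_0(x)=0$ for $x\neq 0$, which evolves by the Schrödinger equation $$i\,\frac{d}{dt}\psi_t(2n)=\gamma_1\,\psi_t(2n-1)+\gamma_0\,\psi_t(2n+1),\qquad i\,\frac{d}{dt}\psi_t(2n+1)=\gamma_0\,\psi_t(2n)+\gamma_1\,\psi_t(2n+2)\qquad(n\in\mathbb{Z},\ t\ge 0),$$ with $\sum_{x\in\mathbb{Z}}|\psi_t(x)|^2=1$ for all $t\ge 0$. Let $X_t$ be the position of the walker at time $t$, a $\mathbb{Z}$-valued random variable with $\mathbb{P}(X_t=x)=|\psi_t(x)|^2$. Let $\xi\in\{0,1\}$ be such that $|\gamma_\xi|=\min\{|\gamma_0|,|\gamma_1|\}$. Then $X_t/t$ converges in distribution as $t\to\infty$ to the law with density $$f(y)=\frac{1}{\pi\sqrt{4\gamma_\xi^2-y^2}}\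 \text{ for } -2|\gamma_\xi|<y<2|\gamma_\xi|,\qquad f(y)=0\ \text{ otherwise};$$ that is, $f$ is integrable with $\int_{-\infty}^{\infty}f(y)\,dy=1$, and for every real number $x$ $$\lim_{t\to\infty}\mathbb{P}\left(\frac{X_t}{t}\le x\right)=\int_{-\infty}^{x}f(y)\,dy .$$ -/

import Mathlib

open MeasureTheory Filter Topology Set

/-- `ψ t x` is the probability amplitude at time `t ≥ 0` and position `x ∈ ℤ` of the continuous-time
quantum walk with hopping parameters `γ 0`, `γ 1` that starts at the origin: it starts from the unit
mass at `0`, solves the Schrödinger equation `i (d/dt) ψ_t = H ψ_t` of the 2-periodic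
nearest-neighbour Hamiltonian (one-sided derivative at `t = 0`), and `|ψ_t(x)|²` is a probability
distribution on `ℤ` at every time. (Square summability selects the unitary evolution: the
coordinatewise equations alone do not determine `ψ`.) Only the values for `t ≥ 0` matter. -/
structure IsQuantumWalk (γ : Fin 2 → ℝ) (ψ : ℝ → ℤ → ℂ) : Prop where
  initial_zero : ψ 0 0 = 1
  initial_ne : ∀ x : ℤ, x ≠ 0 → ψ 0 x = 0
  differentiable : ∀ x : ℤ, DifferentiableOn ℝ (fun t => ψ t x) (Ici 0)
  evolution_even : ∀ n : ℤ, ∀ t : ℝ, 0 ≤ t →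
    Complex.I * derivWithin (fun s => ψ s (2 * n)) (Ici 0) t =
      (γ 1 : ℂ) * ψ t (2 * n - 1) + (γ 0 : ℂ) * ψ t (2 * n + 1)
  evolution_odd : ∀ n : ℤ, ∀ t : ℝ, 0 ≤ t →
    Complex.I * derivWithin (fun s => ψ s (2 * n + 1)) (Ici 0) t =
      (γ 0 : ℂ) * ψ t (2 * n) + (γ 1 : ℂ) * ψ t (2 * n + 2)
  total_probability : ∀ t : ℝ, 0 ≤ t → HasSum (fun x : ℤ => ‖ψ t x‖ ^ 2) 1

/-- The density `1 / (π √(4 c² - y²))` on `(-2|c|, 2|c|)`, zero elsewhere. -/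
noncomputable def arcsineDensity (c : ℝ) : ℝ → ℝ :=
  (Ioo (-2 * |c|) (2 * |c|)).indicator
    (fun y => 1 / (Real.pi * Real.sqrt (4 * c ^ 2 - y ^ 2)))

/-! Grouping the sites 2n and 2n+1 into one cell and passing to Fourier series turns the Schrödinger
equation into a two-level system with off-diagonal entry h(θ) = γ₀ + γ₁e^{iθ}, solved by cos(t|h|)
on even sites and -i(h̄/|h|) sin(t|h|) on odd ones. Total probability bounds the amplitudes by 1,
and bounded solutions are unique, so the walk consists of the Fourier coefficients of this solution
(`IsQuantumWalk.eq_fourierCoeff`).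

By Parseval, the characteristic function of X_t at u is the overlap of the momentum-space state with
its translate by 2u. At u = s/t this overlap is cos(t(|h(θ+2s/t)| - |h(θ)|)) plus a vanishing error,
so it tends to cos(2s v(θ)) with v = |h|' (`tendsto_overlap`). The limit law is therefore that of
2v(θ) with θ uniform, symmetric because v is odd.

With a, b the two parameters ordered so that |a| < |b|, the substitution θ = φ + arcsin((a/b) sin φ)
gives |v| = |a sin φ|, and its Jacobian is 1 plus a term contributing nothing to the integral
(`intervalIntegral_comp_groupVelocity`). So the limit is the law of 2a sin φ with φ uniform, an
arcsine law, and Lévy's continuity theorem concludes. -/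

/-! ### Uniqueness of bounded solutions -/

/-- A family of functions bounded uniformly by a constant, starting at zero, whose derivatives are
controlled in sup norm by the family itself, vanishes. -/
theorem eq_zero_of_norm_deriv_le_sup {ι : Type*} {d d' : ℝ → ι → ℂ} {K M : ℝ}
    (hd : ∀ x t, 0 ≤ t → HasDerivWithinAt (fun s => d s x) (d' t x) (Ici 0) t)
    (h0 : ∀ x, d 0 x = 0) (hM : ∀ t x, 0 ≤ t → ‖d t x‖ ≤ M)
    (hK : ∀ t C, 0 ≤ t → (∀ x, ‖d t x‖ ≤ C) → ∀ x, ‖d' t x‖ ≤ K * C) :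
    ∀ t x, 0 ≤ t → d t x = 0 := by
  -- Iterated Grönwall: each integration of the derivative bound gains a factor Kt/(n+1), and the
  -- factorial eventually wins.
  have key : ∀ n : ℕ, ∀ t x, 0 ≤ t → ‖d t x‖ ≤ M * ((K * t) ^ n / n.factorial) := by
    intro n
    induction n with
    | zero => simpa using hM
    | succ n ih =>
      intro t x ht
      refine image_norm_le_of_norm_deriv_right_le_deriv_boundary (f := fun s => d s x)
        (f' := fun s => d' s x) (a := 0) (b := t)
        (B := fun s => M * ((K * s) ^ (n + 1) / (n + 1).factorial))
        (B' := fun s => K * (M * ((K * s) ^ n / n.factorial))) ?_ ?_ ?_ ?_ ?_ ⟨ht, le_rfl⟩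
      · exact fun s hs => (hd x s hs.1).continuousWithinAt.mono Icc_subset_Ici_self
      · exact fun s hs => (hd x s hs.1).mono (Ici_subset_Ici.2 hs.1)
      · simp [h0]
      · intro s
        have h := ((((hasDerivAt_id s).const_mul K).pow (n + 1)).div_const
          ((n + 1).factorial : ℝ)).const_mul M
        convert! h using 1
        have : (n.factorial : ℝ) ≠ 0 := by positivity
        simp only [Nat.factorial_succ, id]
        push_cast
        field_simp
      · exact fun s hs => hK s _ hs.1 (fun y => ih s y hs.1) x
  intro t x ht
  have h1 : Tendsto (fun n : ℕ => M * ((K * t) ^ n / n.factorial)) atTop (𝓝 (M * 0)) :=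
    (FloorSemiring.tendsto_pow_div_factorial_atTop (K * t)).const_mul M
  have h2 := ge_of_tendsto' h1 (fun n => key n t x ht)
  simpa using h2

/-! ### Fourier coefficients on the circle -/

open AddCircle in
/-- Polarized Parseval identity for continuous functions on the circle. -/
theorem hasSum_conj_fourierCoeff_mul {T : ℝ} [Fact (0 < T)] (F G : C(AddCircle T, ℂ)) :
    HasSum (fun n : ℤ => (starRingEnd ℂ) (fourierCoeff F n) * fourierCoeff G n)
      (∫ θ, (starRingEnd ℂ) (F θ) * G θ ∂haarAddCircle) := by
  have h := (fourierBasis (T := T)).hasSum_inner_mul_inner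
    (ContinuousMap.toLp (E := ℂ) 2 haarAddCircle ℂ F)
    (ContinuousMap.toLp (E := ℂ) 2 haarAddCircle ℂ G)
  rw [ContinuousMap.inner_toLp] at h
  convert! h using 2 with n
  · rw [← inner_conj_symm, ← HilbertBasis.repr_apply_apply, ← HilbertBasis.repr_apply_apply,
      fourierBasis_repr, fourierBasis_repr, fourierCoeff_toLp, fourierCoeff_toLp]
  · simp [mul_comm]

open AddCircle in
theorem fourierCoeff_comp_add_right {T : ℝ} [Fact (0 < T)] (F : AddCircle T → ℂ) (v : AddCircle T)
    (n : ℤ) : fourierCoeff (fun θ => F (θ + v)) n = fourier n v * fourierCoeff F n := by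
  unfold fourierCoeff
  rw [← integral_const_mul,
    ← integral_add_right_eq_self (fun θ => fourier n v * (fourier (-n) θ • F θ)) v]
  congr 1 with θ
  have h : fourier n v * fourier (-n) v = 1 := by
    rw [← fourier_add]; simp
  have h2 : fourier (-n) (θ + v) = fourier (-n) θ * fourier (-n) v := by
    simp [fourier_apply, AddCircle.toCircle_add]
  rw [h2, smul_eq_mul, smul_eq_mul]
  linear_combination (-(fourier (-n) θ * F (θ + v))) * h

open AddCircle in
theorem norm_fourierCoeff_le {T : ℝ} [Fact (0 < T)] {F : AddCircle T → ℂ} {C : ℝ}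
    (h : ∀ θ, ‖F θ‖ ≤ C) (n : ℤ) : ‖fourierCoeff F n‖ ≤ C := by
  unfold fourierCoeff
  refine (norm_integral_le_of_norm_le_const (C := C) (ae_of_all _ fun θ => ?_)).trans (by simp)
  rw [norm_smul, fourier_apply, Circle.norm_coe, one_mul]
  exact h θ

open AddCircle in
/-- Fourier coefficients may be differentiated under the integral sign. -/
theorem hasDerivAt_fourierCoeff {T : ℝ} [Fact (0 < T)] {F F' : ℝ → AddCircle T → ℂ} {C : ℝ}
    (hF : ∀ t, Continuous (F t)) (hF' : ∀ t, Continuous (F' t))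
    (hd : ∀ t θ, HasDerivAt (fun s => F s θ) (F' t θ) t) (hC : ∀ t θ, ‖F' t θ‖ ≤ C)
    (n : ℤ) (t : ℝ) :
    HasDerivAt (fun s => fourierCoeff (F s) n) (fourierCoeff (F' t) n) t := by
  refine (hasDerivAt_integral_of_dominated_loc_of_deriv_le (μ := haarAddCircle) (s := univ)
    (F := fun s θ => fourier (-n) θ • F s θ) (F' := fun s θ => fourier (-n) θ • F' s θ)
    (bound := fun _ => C) univ_mem ?_ ?_ ?_ ?_ ?_ ?_).2
  · exact Eventually.of_forall fun s =>
      ((fourier (-n)).continuous.smul (hF s)).aestronglyMeasurable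
  · exact ((fourier (-n)).continuous.smul (hF t)).integrable_of_hasCompactSupport
      (HasCompactSupport.of_compactSpace _)
  · exact ((fourier (-n)).continuous.smul (hF' t)).aestronglyMeasurable
  · exact ae_of_all _ fun θ s _ => by
      rw [norm_smul, fourier_apply, Circle.norm_coe, one_mul]
      exact hC s θ
  · exact integrable_const C
  · exact ae_of_all _ fun θ s _ => (hd s θ).const_mul (fourier (-n) θ)

theorem HasSum.int_even_add_int_odd {E : Type*} [AddCommMonoid E] [TopologicalSpace E]
    [ContinuousAdd E] {f : ℤ → E} {a b : E}
    (he : HasSum (fun n : ℤ => f (2 * n)) a) (ho : HasSum (fun n : ℤ => f (2 * n + 1)) b) :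
    HasSum f (a + b) := by
  have h2 := mul_right_injective₀ (two_ne_zero' ℤ)
  replace ho := ((add_left_injective (1 : ℤ)).comp h2).hasSum_range_iff.2 ho
  refine (h2.hasSum_range_iff.2 he).add_isCompl ?_ ho
  have hr : range (fun n : ℤ => 2 * n) = {n | Even n} := by
    ext n; simp [even_iff_exists_two_mul]
  have hs : range ((fun x : ℤ => x + 1) ∘ fun n => 2 * n) = {n | Odd n} := by
    ext n; simp [Odd, eq_comm]
  rw [hr, hs]
  exact Int.isCompl_even_odd

/-! ### Solution in momentum space -/

namespace QuantumWalk

noncomputable section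

instance factTwoPiPos : Fact (0 < 2 * Real.pi) := ⟨by positivity⟩

/-- The momentum space of the walk. -/
abbrev Momentum := AddCircle (2 * Real.pi)

/-- The off-diagonal entry of the Bloch Hamiltonian of the 2-periodic chain. -/
def symbol (a b : ℝ) (θ : Momentum) : ℂ := a + b * fourier 1 θ

/-- The even-site amplitude of the walk in momentum space. -/
def evenAmp (a b t : ℝ) (θ : Momentum) : ℂ := Real.cos (t * ‖symbol a b θ‖)

/-- The odd-site amplitude of the walk in momentum space. -/
def oddAmp (a b t : ℝ) (θ : Momentum) : ℂ :=
  -Complex.I * ((starRingEnd ℂ) (symbol a b θ) / ‖symbol a b θ‖) *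
    Real.sin (t * ‖symbol a b θ‖)

variable {a b : ℝ}

@[fun_prop]
theorem continuous_symbol : Continuous (symbol a b) := by
  unfold symbol; fun_prop

/-- The spectral gap stays open when |a| ≠ |b|. This makes the phase h/|h| continuous and |h|
differentiable. -/
theorem symbol_ne_zero (hab : |a| ≠ |b|) (θ : Momentum) : symbol a b θ ≠ 0 := by
  intro h
  apply hab
  have h1 : (a : ℂ) = -(b * fourier 1 θ) := by
    rw [symbol] at h; linear_combination h
  have h2 := congrArg norm h1
  rw [norm_neg, norm_mul, fourier_apply, Circle.norm_coe] at h2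
  simpa using h2

theorem norm_symbol_le (θ : Momentum) : ‖symbol a b θ‖ ≤ |a| + |b| := by
  refine (norm_add_le _ _).trans ?_
  rw [norm_mul, fourier_apply, Circle.norm_coe]
  simp

@[fun_prop]
theorem continuous_evenAmp (t : ℝ) : Continuous (evenAmp a b t) := by
  unfold evenAmp; fun_prop

theorem continuous_oddAmp (hab : |a| ≠ |b|) (t : ℝ) : Continuous (oddAmp a b t) := by
  unfold oddAmp
  have h : ∀ θ, (‖symbol a b θ‖ : ℂ) ≠ 0 := fun θ => by
    simpa using symbol_ne_zero hab θ
  have h2 : Continuous fun θ => (starRingEnd ℂ) (symbol a b θ) :=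
    Complex.continuous_conj.comp continuous_symbol
  fun_prop (disch := assumption)

theorem norm_evenAmp_le (t : ℝ) (θ : Momentum) : ‖evenAmp a b t θ‖ ≤ 1 := by
  rw [evenAmp, Complex.norm_real]
  exact Real.abs_cos_le_one _

theorem norm_conj_div_norm_le (z : ℂ) : ‖(starRingEnd ℂ) z / ‖z‖‖ ≤ 1 := by
  rw [norm_div, RCLike.norm_conj, Complex.norm_real, norm_norm]
  exact div_self_le_one _

theorem norm_oddAmp_le (t : ℝ) (θ : Momentum) : ‖oddAmp a b t θ‖ ≤ 1 := by
  rw [oddAmp, norm_mul, norm_mul, norm_neg, Complex.norm_I, one_mul, Complex.norm_real]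
  exact mul_le_one₀ (norm_conj_div_norm_le _) (norm_nonneg _) (Real.abs_sin_le_one _)

theorem hasDerivAt_evenAmp (hab : |a| ≠ |b|) (t : ℝ) (θ : Momentum) :
    HasDerivAt (fun s => evenAmp a b s θ) (-Complex.I * (symbol a b θ * oddAmp a b t θ)) t := by
  have h := (((hasDerivAt_id t).mul_const ‖symbol a b θ‖).cos).ofReal_comp
  convert! h using 1
  have h0 : (‖symbol a b θ‖ : ℂ) ≠ 0 := by simpa using symbol_ne_zero hab θ
  have h1 := Complex.mul_conj' (symbol a b θ)
  rw [oddAmp]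
  simp only [id, Complex.ofReal_mul, Complex.ofReal_neg, one_mul]
  field_simp
  rw [Complex.I_sq]
  linear_combination (-(Real.sin (t * ‖symbol a b θ‖) : ℂ)) * h1

theorem hasDerivAt_oddAmp (hab : |a| ≠ |b|) (t : ℝ) (θ : Momentum) :
    HasDerivAt (fun s => oddAmp a b s θ)
      (-Complex.I * ((starRingEnd ℂ) (symbol a b θ) * evenAmp a b t θ)) t := by
  have h := ((((hasDerivAt_id t).mul_const ‖symbol a b θ‖).sin).ofReal_comp).const_mul
    (-Complex.I * ((starRingEnd ℂ) (symbol a b θ) / ‖symbol a b θ‖))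
  convert! h using 1
  have h0 : (‖symbol a b θ‖ : ℂ) ≠ 0 := by simpa using symbol_ne_zero hab θ
  rw [evenAmp]
  simp only [id, Complex.ofReal_mul, one_mul]
  field_simp

/-- Multiplication by e^{iθ} shifts the Fourier index by one, so the symbol acts as hopping from the
odd sites 2n-1 and 2n+1 onto 2n. -/
theorem fourierCoeff_symbol_mul {F : Momentum → ℂ} (hF : Continuous F) (n : ℤ) :
    fourierCoeff (fun θ => symbol a b θ * F θ) n =
      b * fourierCoeff F (n - 1) + a * fourierCoeff F n := by
  have hi : ∀ G : Momentum → ℂ, Continuous G → Integrable G AddCircle.haarAddCircle :=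
    fun G hG => hG.integrable_of_hasCompactSupport (HasCompactSupport.of_compactSpace _)
  unfold fourierCoeff
  rw [← integral_const_mul, ← integral_const_mul, ← integral_add]
  · congr 1 with θ
    rw [show -(n - 1) = -n + 1 by ring, fourier_add]
    simp only [symbol, smul_eq_mul]
    ring
  · exact hi _ (by fun_prop)
  · exact hi _ (by fun_prop)

theorem fourierCoeff_conj_symbol_mul {F : Momentum → ℂ} (hF : Continuous F) (n : ℤ) :
    fourierCoeff (fun θ => (starRingEnd ℂ) (symbol a b θ) * F θ) n =
      a * fourierCoeff F n + b * fourierCoeff F (n + 1) := by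
  have hi : ∀ G : Momentum → ℂ, Continuous G → Integrable G AddCircle.haarAddCircle :=
    fun G hG => hG.integrable_of_hasCompactSupport (HasCompactSupport.of_compactSpace _)
  unfold fourierCoeff
  rw [← integral_const_mul, ← integral_const_mul, ← integral_add]
  · congr 1 with θ
    rw [show -(n + 1) = -n + -1 by ring, fourier_add, fourier_neg (n := 1)]
    simp only [symbol, smul_eq_mul, map_add, map_mul, Complex.conj_ofReal]
    ring
  · exact hi _ (by fun_prop)
  · exact hi _ (by fun_prop)

theorem hasDerivAt_fourierCoeff_evenAmp (hab : |a| ≠ |b|) (n : ℤ) (t : ℝ) :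
    HasDerivAt (fun s => fourierCoeff (evenAmp a b s) n)
      (-Complex.I * (b * fourierCoeff (oddAmp a b t) (n - 1) +
        a * fourierCoeff (oddAmp a b t) n)) t := by
  have ho := fun t => continuous_oddAmp hab t
  have h := hasDerivAt_fourierCoeff (C := |a| + |b|) (fun t => continuous_evenAmp (a := a) (b := b) t)
    (fun t => by have := ho t; fun_prop) (hasDerivAt_evenAmp hab) (fun t θ => ?_) n t
  · rw [fourierCoeff.const_mul, fourierCoeff_symbol_mul (ho t)] at h
    exact h
  · rw [norm_mul, norm_neg, Complex.norm_I, one_mul, norm_mul]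
    exact (mul_le_of_le_one_right (norm_nonneg _) (norm_oddAmp_le _ _)).trans (norm_symbol_le _)

theorem hasDerivAt_fourierCoeff_oddAmp (hab : |a| ≠ |b|) (n : ℤ) (t : ℝ) :
    HasDerivAt (fun s => fourierCoeff (oddAmp a b s) n)
      (-Complex.I * (a * fourierCoeff (evenAmp a b t) n +
        b * fourierCoeff (evenAmp a b t) (n + 1))) t := by
  have h2 : Continuous fun θ => (starRingEnd ℂ) (symbol a b θ) :=
    Complex.continuous_conj.comp continuous_symbol
  have h := hasDerivAt_fourierCoeff (C := |a| + |b|) (fun t => continuous_oddAmp hab t)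
    (fun t => by fun_prop) (hasDerivAt_oddAmp hab) (fun t θ => ?_) n t
  · rw [fourierCoeff.const_mul, fourierCoeff_conj_symbol_mul (continuous_evenAmp t)] at h
    exact h
  · rw [norm_mul, norm_neg, Complex.norm_I, one_mul, norm_mul, RCLike.norm_conj]
    exact (mul_le_of_le_one_right (norm_nonneg _) (norm_evenAmp_le _ _)).trans (norm_symbol_le _)

theorem fourierCoeff_evenAmp_zero (n : ℤ) :
    fourierCoeff (evenAmp a b 0) n = if n = 0 then 1 else 0 := by
  have h : evenAmp a b 0 = fourier 0 := by
    ext θ; simp [evenAmp]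
  rw [h, fourierCoeff_fourier, Pi.single_apply]

theorem fourierCoeff_oddAmp_zero (n : ℤ) : fourierCoeff (oddAmp a b 0) n = 0 := by
  simp [fourierCoeff, oddAmp]

end

end QuantumWalk

/-! ### Identification of the walk -/

open QuantumWalk in
/-- The amplitudes of the walk are the Fourier coefficients of the momentum-space evolution. -/
theorem IsQuantumWalk.eq_fourierCoeff {γ : Fin 2 → ℝ} {ψ : ℝ → ℤ → ℂ} (hψ : IsQuantumWalk γ ψ)
    (hγ : |γ 0| ≠ |γ 1|) {t : ℝ} (ht : 0 ≤ t) (n : ℤ) :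
    ψ t (2 * n) = fourierCoeff (evenAmp (γ 0) (γ 1) t) n ∧
      ψ t (2 * n + 1) = fourierCoeff (oddAmp (γ 0) (γ 1) t) n := by
  have hle : ∀ t x, 0 ≤ t → ‖ψ t x‖ ≤ 1 := fun t x ht => by
    have h := le_hasSum (hψ.total_probability t ht) x (fun _ _ => by positivity)
    exact (sq_le_one_iff₀ (norm_nonneg _)).1 h
  have hderiv : ∀ x t c, 0 ≤ t → Complex.I * derivWithin (fun s => ψ s x) (Ici 0) t = c →
      HasDerivWithinAt (fun s => ψ s x) (-Complex.I * c) (Ici 0) t := fun x t c ht h => by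
    have h1 := (hψ.differentiable x t ht).hasDerivWithinAt
    convert! h1 using 1
    rw [← h]
    linear_combination (-derivWithin (fun s => ψ s x) (Ici 0) t) * Complex.I_sq
  -- The two summands of ℤ ⊕ ℤ index even and odd sites. `M = 2` since both solutions are bounded by
  -- 1; `K` is the sup-norm bound of the hopping operator.
  have key := eq_zero_of_norm_deriv_le_sup (ι := ℤ ⊕ ℤ)
    (d := fun t => Sum.elim (fun n => ψ t (2 * n) - fourierCoeff (evenAmp (γ 0) (γ 1) t) n)
      (fun n => ψ t (2 * n + 1) - fourierCoeff (oddAmp (γ 0) (γ 1) t) n))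
    (d' := fun t => Sum.elim
      (fun n => -Complex.I * (γ 1 * ψ t (2 * n - 1) + γ 0 * ψ t (2 * n + 1)) -
        -Complex.I * (γ 1 * fourierCoeff (oddAmp (γ 0) (γ 1) t) (n - 1) +
          γ 0 * fourierCoeff (oddAmp (γ 0) (γ 1) t) n))
      (fun n => -Complex.I * (γ 0 * ψ t (2 * n) + γ 1 * ψ t (2 * n + 2)) -
        -Complex.I * (γ 0 * fourierCoeff (evenAmp (γ 0) (γ 1) t) n +
          γ 1 * fourierCoeff (evenAmp (γ 0) (γ 1) t) (n + 1))))
    (K := |γ 0| + |γ 1|) (M := 2) ?_ ?_ ?_ ?_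
  · exact ⟨sub_eq_zero.1 (key t (.inl n) ht), sub_eq_zero.1 (key t (.inr n) ht)⟩
  · rintro (n | n) t ht
    · exact (hderiv _ t _ ht (hψ.evolution_even n t ht)).sub
        (hasDerivAt_fourierCoeff_evenAmp hγ n t).hasDerivWithinAt
    · exact (hderiv _ t _ ht (hψ.evolution_odd n t ht)).sub
        (hasDerivAt_fourierCoeff_oddAmp hγ n t).hasDerivWithinAt
  · rintro (n | n)
    · rcases eq_or_ne n 0 with rfl | hn
      · simp [fourierCoeff_evenAmp_zero, hψ.initial_zero]
      · simp [fourierCoeff_evenAmp_zero, hψ.initial_ne (2 * n) (by omega), hn]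
    · simp [fourierCoeff_oddAmp_zero, hψ.initial_ne (2 * n + 1) (by omega)]
  · rintro t (n | n) ht
    · exact (norm_sub_le _ _).trans ((add_le_add (hle t _ ht)
        (norm_fourierCoeff_le (norm_evenAmp_le t) n)).trans (by norm_num))
    · exact (norm_sub_le _ _).trans ((add_le_add (hle t _ ht)
        (norm_fourierCoeff_le (norm_oddAmp_le t) n)).trans (by norm_num))
  · have hcomb : ∀ (p q : ℝ) (z w : ℂ) (C : ℝ), ‖z‖ ≤ C → ‖w‖ ≤ C →
        ‖-Complex.I * (p * z + q * w)‖ ≤ (|p| + |q|) * C := fun p q z w C hz hw => by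
      rw [norm_mul, norm_neg, Complex.norm_I, one_mul, add_mul]
      refine (norm_add_le _ _).trans (add_le_add ?_ ?_)
      · rw [norm_mul, Complex.norm_real, Real.norm_eq_abs]; gcongr
      · rw [norm_mul, Complex.norm_real, Real.norm_eq_abs]; gcongr
    rintro t C ht hC (n | n)
    · have h1 := hC (.inr (n - 1))
      have h2 := hC (.inr n)
      simp only [Sum.elim_inr] at h1 h2
      rw [show 2 * (n - 1) + 1 = 2 * n - 1 by ring] at h1
      convert! hcomb (γ 0) (γ 1) _ _ C h2 h1 using 2
      simp only [Sum.elim_inl]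
      ring
    · have h1 := hC (.inl n)
      have h2 := hC (.inl (n + 1))
      simp only [Sum.elim_inl] at h1 h2
      rw [show 2 * (n + 1) = 2 * n + 2 by ring] at h2
      convert! hcomb (γ 0) (γ 1) _ _ C h1 h2 using 2
      simp only [Sum.elim_inr]
      ring

/-! ### Characteristic function and its limit -/

namespace QuantumWalk

noncomputable section

/-- The overlap of the momentum-space state with its translate by `2 * u`. -/
def overlap (a b t u : ℝ) (θ : Momentum) : ℂ :=
  (starRingEnd ℂ) (evenAmp a b t θ) * evenAmp a b t (θ + (2 * u : ℝ)) +
    Complex.exp (u * Complex.I) *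
      ((starRingEnd ℂ) (oddAmp a b t θ) * oddAmp a b t (θ + (2 * u : ℝ)))

/-- Parseval for F and its translate: translating by 2u multiplies the n-th coefficient by e^{2iun},
where 2n is the position of the cell. -/
theorem hasSum_norm_sq_fourierCoeff_mul {F : Momentum → ℂ} (hF : Continuous F) (u : ℝ) :
    HasSum (fun n : ℤ => (‖fourierCoeff F n‖ ^ 2 : ℂ) * Complex.exp (u * (2 * n) * Complex.I))
      (∫ θ, (starRingEnd ℂ) (F θ) * F (θ + (2 * u : ℝ)) ∂AddCircle.haarAddCircle) := by
  have h := hasSum_conj_fourierCoeff_mul (T := 2 * Real.pi) ⟨F, hF⟩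
    ⟨fun θ => F (θ + (2 * u : ℝ)), by fun_prop⟩
  simp only [ContinuousMap.coe_mk, fourierCoeff_comp_add_right] at h
  convert! h using 2 with n
  rw [fourier_coe_apply, ← Complex.conj_mul']
  have hpi : (Real.pi : ℂ) ≠ 0 := by exact_mod_cast Real.pi_ne_zero
  rw [show 2 * (Real.pi : ℂ) * Complex.I * n * ((2 * u : ℝ) : ℂ) / ((2 * Real.pi : ℝ) : ℂ) =
    u * (2 * n) * Complex.I by push_cast; field_simp]
  ring

variable {a b : ℝ}

theorem continuous_overlap (hab : |a| ≠ |b|) (t u : ℝ) : Continuous (overlap a b t u) := by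
  have h := continuous_oddAmp hab t
  have h1 : Continuous fun θ => (starRingEnd ℂ) (evenAmp a b t θ) :=
    Complex.continuous_conj.comp (continuous_evenAmp t)
  have h2 : Continuous fun θ => (starRingEnd ℂ) (oddAmp a b t θ) :=
    Complex.continuous_conj.comp h
  unfold overlap
  fun_prop

theorem norm_overlap_le (t u : ℝ) (θ : Momentum) : ‖overlap a b t u θ‖ ≤ 2 := by
  have h1 : ‖(starRingEnd ℂ) (evenAmp a b t θ) * evenAmp a b t (θ + (2 * u : ℝ))‖ ≤ 1 := by
    rw [norm_mul, RCLike.norm_conj]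
    exact mul_le_one₀ (norm_evenAmp_le _ _) (norm_nonneg _) (norm_evenAmp_le _ _)
  have h2 : ‖(starRingEnd ℂ) (oddAmp a b t θ) * oddAmp a b t (θ + (2 * u : ℝ))‖ ≤ 1 := by
    rw [norm_mul, RCLike.norm_conj]
    exact mul_le_one₀ (norm_oddAmp_le _ _) (norm_nonneg _) (norm_oddAmp_le _ _)
  refine (norm_add_le _ _).trans ?_
  rw [norm_mul (Complex.exp _), Complex.norm_exp_ofReal_mul_I, one_mul]
  linarith

/-- The group velocity per unit cell. -/
def groupVelocity (a b x : ℝ) : ℝ := -(a * b * Real.sin x) / ‖symbol a b (x : Momentum)‖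

theorem symbol_coe (x : ℝ) :
    symbol a b (x : Momentum) = (a + b * Real.cos x : ℝ) + (b * Real.sin x : ℝ) * Complex.I := by
  have hpi : (Real.pi : ℂ) ≠ 0 := by exact_mod_cast Real.pi_ne_zero
  rw [symbol, fourier_coe_apply,
    show 2 * (Real.pi : ℂ) * Complex.I * (1 : ℤ) * x / ((2 * Real.pi : ℝ) : ℂ) =
      x * Complex.I by push_cast; field_simp, Complex.exp_mul_I]
  push_cast
  ring

theorem norm_symbol_coe (x : ℝ) :
    ‖symbol a b (x : Momentum)‖ = √((a + b * Real.cos x) ^ 2 + (b * Real.sin x) ^ 2) := by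
  rw [symbol_coe, Complex.norm_add_mul_I]

theorem hasDerivAt_norm_symbol (hab : |a| ≠ |b|) (x : ℝ) :
    HasDerivAt (fun y : ℝ => ‖symbol a b (y : Momentum)‖) (groupVelocity a b x) x := by
  have h0 : ‖symbol a b (x : Momentum)‖ ≠ 0 := by simpa using symbol_ne_zero hab _
  have h1 := (((((Real.hasDerivAt_cos x).const_mul b).const_add a).pow 2).add
    (((Real.hasDerivAt_sin x).const_mul b).pow 2)).sqrt (by
      intro h
      rw [norm_symbol_coe] at h0
      exact h0 (Real.sqrt_eq_zero'.2 h.le))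
  have h2 : (fun y : ℝ => ‖symbol a b (y : Momentum)‖) =
      fun y => √((a + b * Real.cos y) ^ 2 + (b * Real.sin y) ^ 2) := by
    ext y; exact norm_symbol_coe y
  rw [h2]
  convert! h1 using 1
  simp only [Pi.add_apply, Pi.pow_apply]
  rw [groupVelocity, ← norm_symbol_coe]
  field_simp
  ring

/-- Isolates cos A cos B + sin A sin B = cos(A - B); the leftover factor vanishes as u → 0, when the
two phases cancel. -/
theorem overlap_eq (t u : ℝ) (θ : Momentum) :
    overlap a b t u θ =
      (Real.cos (t * (‖symbol a b (θ + (2 * u : ℝ))‖ - ‖symbol a b θ‖)) : ℂ) +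
      (Complex.exp (u * Complex.I) *
        ((symbol a b θ / ‖symbol a b θ‖) * ((starRingEnd ℂ) (symbol a b (θ + (2 * u : ℝ))) /
          ‖symbol a b (θ + (2 * u : ℝ))‖)) - 1) *
        (Real.sin (t * ‖symbol a b θ‖) * Real.sin (t * ‖symbol a b (θ + (2 * u : ℝ))‖) : ℝ) := by
  rw [overlap, evenAmp, evenAmp, oddAmp, oddAmp, mul_sub, Real.cos_sub]
  simp only [map_mul, map_neg, map_div₀, Complex.conj_I, Complex.conj_conj, Complex.conj_ofReal]
  push_cast
  linear_combination (- Complex.exp (u * Complex.I) *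
        ((symbol a b θ / ‖symbol a b θ‖) * ((starRingEnd ℂ) (symbol a b (θ + (2 * u : ℝ))) /
          ‖symbol a b (θ + (2 * u : ℝ))‖)) * Complex.sin (t * ‖symbol a b θ‖) *
          Complex.sin (t * ‖symbol a b (θ + (2 * u : ℝ))‖)) * Complex.I_sq

theorem tendsto_overlap (hab : |a| ≠ |b|) (s x : ℝ) :
    Tendsto (fun t : ℝ => overlap a b t (s / t) (x : Momentum)) atTop
      (𝓝 (Real.cos (2 * s * groupVelocity a b x) : ℝ)) := by
  have hu : Tendsto (fun t : ℝ => s / t) atTop (𝓝 0) := tendsto_id.const_div_atTop s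
  have hphase : Tendsto (fun t : ℝ => t * (‖symbol a b ((x : Momentum) + (2 * (s / t) : ℝ))‖ -
      ‖symbol a b (x : Momentum)‖)) atTop (𝓝 (2 * s * groupVelocity a b x)) := by
    have hl : HasDerivAt (fun τ : ℝ => x + τ * (2 * s)) (2 * s) 0 := by
      simpa using ((hasDerivAt_id (0 : ℝ)).mul_const (2 * s)).const_add x
    have h1 : HasDerivAt (fun τ : ℝ => ‖symbol a b ((x + τ * (2 * s) : ℝ) : Momentum)‖)
        (groupVelocity a b x * (2 * s)) 0 :=
      HasDerivAt.comp (h₂ := fun y : ℝ => ‖symbol a b (y : Momentum)‖) 0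
        (by simpa using hasDerivAt_norm_symbol hab x) hl
    -- The phase is a difference quotient of |h| with increment parameter τ = 1/t.
    have h2 := h1.tendsto_slope_zero_right.comp tendsto_inv_atTop_nhdsGT_zero
    rw [mul_comm (2 * s)]
    convert! h2 using 2 with t
    simp only [Function.comp_apply, inv_inv, smul_eq_mul, zero_add, zero_mul, add_zero]
    rw [← AddCircle.coe_add, show x + 2 * (s / t) = x + t⁻¹ * (2 * s) by ring]
  have hcos := ((Complex.continuous_ofReal.comp Real.continuous_cos).tendsto _).comp hphase
  have hsym : ∀ θ, (‖symbol a b θ‖ : ℂ) ≠ 0 := fun θ => by simpa using symbol_ne_zero hab θ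
  have hfac : Tendsto (fun t : ℝ => Complex.exp ((s / t : ℝ) * Complex.I) *
      ((symbol a b x / ‖symbol a b x‖) * ((starRingEnd ℂ)
        (symbol a b ((x : Momentum) + (2 * (s / t) : ℝ))) /
          ‖symbol a b ((x : Momentum) + (2 * (s / t) : ℝ))‖)) - 1) atTop (𝓝 0) := by
    have hc : Continuous (fun u : ℝ => Complex.exp ((u : ℝ) * Complex.I) *
      ((symbol a b x / ‖symbol a b x‖) * ((starRingEnd ℂ)
        (symbol a b ((x : Momentum) + (2 * u : ℝ))) /
          ‖symbol a b ((x : Momentum) + (2 * u : ℝ))‖)) - 1) := by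
      have h0 : Continuous fun u : ℝ => (x : Momentum) + ((2 * u : ℝ) : Momentum) :=
        continuous_const.add ((AddCircle.continuous_mk' _).comp (by fun_prop))
      have h1 : Continuous fun u : ℝ => symbol a b ((x : Momentum) + ((2 * u : ℝ) : Momentum)) :=
        continuous_symbol.comp h0
      have h2 := Complex.continuous_conj.comp h1
      have h3 := Complex.continuous_ofReal.comp h1.norm
      exact ((by fun_prop : Continuous fun u : ℝ => Complex.exp ((u : ℝ) * Complex.I)).mul
        (continuous_const.mul (h2.div h3 fun u => hsym _))).sub continuous_const
    have := (hc.tendsto 0).comp hu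
    convert! this using 2
    have h1 := Complex.mul_conj' (symbol a b x)
    have h2 := hsym x
    simp only [mul_zero, AddCircle.coe_zero, add_zero, Complex.ofReal_zero, zero_mul,
      Complex.exp_zero, one_mul]
    field_simp
    rw [h1, sub_self, zero_mul]
  have hrest := hfac.zero_mul_isBoundedUnder_le
    (g := fun t : ℝ => ((Real.sin (t * ‖symbol a b x‖) *
      Real.sin (t * ‖symbol a b ((x : Momentum) + (2 * (s / t) : ℝ))‖) : ℝ) : ℂ))
    (isBoundedUnder_of ⟨1, fun t => by
      simp only [Function.comp_apply, Complex.norm_real, norm_mul]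
      exact mul_le_one₀ (Real.abs_sin_le_one _) (norm_nonneg _) (Real.abs_sin_le_one _)⟩)
  have := hcos.add hrest
  rw [add_zero] at this
  refine this.congr fun t => ?_
  rw [overlap_eq]
  simp only [Function.comp_apply]

theorem tendsto_integral_overlap (hab : |a| ≠ |b|) (s : ℝ) :
    Tendsto (fun t : ℝ => ∫ θ, overlap a b t (s / t) θ ∂AddCircle.haarAddCircle) atTop
      (𝓝 (((2 * Real.pi)⁻¹ * ∫ x in (0 : ℝ)..2 * Real.pi,
        Real.cos (2 * s * groupVelocity a b x) : ℝ) : ℂ)) := by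
  have h : Tendsto (fun t : ℝ => ∫ x in (0 : ℝ)..(0 + 2 * Real.pi),
      overlap a b t (s / t) (x : Momentum)) atTop
      (𝓝 (∫ x in (0 : ℝ)..(0 + 2 * Real.pi), (Real.cos (2 * s * groupVelocity a b x) : ℂ))) := by
    refine intervalIntegral.tendsto_integral_filter_of_dominated_convergence (fun _ => 2)
      ?_ ?_ ?_ ?_
    · exact Eventually.of_forall fun t =>
        ((continuous_overlap hab _ _).comp (AddCircle.continuous_mk' _)).aestronglyMeasurable
    · exact Eventually.of_forall fun t => ae_of_all _ fun x _ => norm_overlap_le _ _ _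
    · exact intervalIntegrable_const
    · exact ae_of_all _ fun x _ => tendsto_overlap hab s x
  simp only [AddCircle.intervalIntegral_preimage] at h
  rw [intervalIntegral.integral_ofReal, zero_add] at h
  have h2 := h.const_smul ((2 * Real.pi)⁻¹)
  convert! h2 using 2 with t
  · rw [AddCircle.integral_haarAddCircle]
  · rw [Complex.real_smul]; push_cast; rfl

end

end QuantumWalk

-- Even and odd sites are summed separately; the position 2n+1 produces the extra factor e^{iu} in
-- the odd part of the overlap.
open QuantumWalk in
theorem IsQuantumWalk.hasSum_norm_sq_mul_exp {γ : Fin 2 → ℝ} {ψ : ℝ → ℤ → ℂ}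
    (hψ : IsQuantumWalk γ ψ) (hγ : |γ 0| ≠ |γ 1|) {t : ℝ} (ht : 0 ≤ t) (u : ℝ) :
    HasSum (fun x : ℤ => (‖ψ t x‖ ^ 2 : ℂ) * Complex.exp (u * x * Complex.I))
      (∫ θ, overlap (γ 0) (γ 1) t u θ ∂AddCircle.haarAddCircle) := by
  have hi : ∀ G : Momentum → ℂ, Continuous G → Integrable G AddCircle.haarAddCircle :=
    fun G hG => hG.integrable_of_hasCompactSupport (HasCompactSupport.of_compactSpace _)
  have hodd := continuous_oddAmp hγ t
  have h1 : Continuous fun θ => (starRingEnd ℂ) (evenAmp (γ 0) (γ 1) t θ) :=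
    Complex.continuous_conj.comp (continuous_evenAmp t)
  have h2 : Continuous fun θ => (starRingEnd ℂ) (oddAmp (γ 0) (γ 1) t θ) :=
    Complex.continuous_conj.comp hodd
  unfold overlap
  rw [integral_add (hi _ (by fun_prop)) (hi _ (by fun_prop)), integral_const_mul]
  refine HasSum.int_even_add_int_odd ?_ ?_
  · convert! hasSum_norm_sq_fourierCoeff_mul (continuous_evenAmp (a := γ 0) (b := γ 1) t) u
      using 2 with n
    rw [(hψ.eq_fourierCoeff hγ ht n).1]
    push_cast
    rfl
  · convert! (hasSum_norm_sq_fourierCoeff_mul hodd u).mul_left (Complex.exp (u * Complex.I))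
      using 2 with n
    rw [(hψ.eq_fourierCoeff hγ ht n).2,
      show (u : ℂ) * ((2 * n + 1 : ℤ) : ℂ) * Complex.I =
        u * Complex.I + u * (2 * n) * Complex.I by push_cast; ring, Complex.exp_add]
    ring

/-! ### Distribution of the group velocity -/

namespace QuantumWalk

/-- |a + be^{ix}|² = a² + b² + 2ab cos x is symmetric in a and b, so |a| < |b| may be assumed below.
-/
theorem groupVelocity_comm (a b x : ℝ) : groupVelocity a b x = groupVelocity b a x := by
  rw [groupVelocity, groupVelocity, norm_symbol_coe, norm_symbol_coe]
  have h := Real.sin_sq_add_cos_sq x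
  rw [show (a + b * Real.cos x) ^ 2 + (b * Real.sin x) ^ 2 =
    (b + a * Real.cos x) ^ 2 + (a * Real.sin x) ^ 2 by linear_combination (b ^ 2 - a ^ 2) * h,
    mul_comm a b]

/-- Law of sines: with α the arcsine term, b sin α = a sin φ, so a + be^{i(φ+α)} = e^{iφ}(ae^{-iφ} +
be^{iα}) has modulus |a cos φ + b cos α|. The numerator ab sin(φ+α) equals a sin φ (a cos φ + b cos
α), and the bracket cancels. -/
theorem abs_groupVelocity_add_arcsin {a b : ℝ} (hab : |a| < |b|) (φ : ℝ) :
    |groupVelocity a b (φ + Real.arcsin (a / b * Real.sin φ))| = |a * Real.sin φ| := by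
  have hb : b ≠ 0 := by
    rintro rfl; simp at hab; exact absurd hab (not_lt.2 (abs_nonneg a))
  have hsq : a ^ 2 < b ^ 2 := sq_lt_sq.2 hab
  have hr : |a / b| ≤ 1 := by
    rw [abs_div]; exact div_le_one_of_le₀ hab.le (abs_nonneg b)
  have hrs : |a / b * Real.sin φ| ≤ 1 := by
    rw [abs_mul]; exact mul_le_one₀ hr (abs_nonneg _) (Real.abs_sin_le_one _)
  set α := Real.arcsin (a / b * Real.sin φ) with hα
  have hsin : b * Real.sin α = a * Real.sin φ := by
    rw [hα, Real.sin_arcsin (abs_le.1 hrs).1 (abs_le.1 hrs).2]; field_simp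
  have h1 := Real.sin_sq_add_cos_sq φ
  have h2 := Real.sin_sq_add_cos_sq α
  have hne : a * Real.cos φ + b * Real.cos α ≠ 0 := by
    intro h
    have h3 : b * Real.cos α = -(a * Real.cos φ) := by linarith
    have : b ^ 2 = a ^ 2 := by
      linear_combination (-(b ^ 2)) * h2 + a ^ 2 * h1 + (b * Real.sin α + a * Real.sin φ) * hsin +
        (b * Real.cos α - a * Real.cos φ) * h3
    exact hsq.ne' this
  have hnorm : ‖symbol a b ((φ + α : ℝ) : Momentum)‖ = |a * Real.cos φ + b * Real.cos α| := by
    rw [norm_symbol_coe, ← Real.sqrt_sq_eq_abs, Real.sin_add, Real.cos_add]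
    congr 1
    linear_combination (b ^ 2 * Real.cos α ^ 2 + b ^ 2 * Real.sin α ^ 2 - a ^ 2) * h1 +
      (b * Real.sin α - a * Real.sin φ) * hsin
  rw [groupVelocity, hnorm, abs_div, abs_abs, abs_neg, div_eq_iff (abs_ne_zero.2 hne), ← abs_mul,
    Real.sin_add]
  congr 1
  linear_combination a * Real.cos φ * hsin

theorem intervalIntegral_comp_groupVelocity {a b : ℝ} (hab : |a| < |b|) {g : ℝ → ℝ}
    (hg : Continuous g) (heven : ∀ y, g (-y) = g y) :
    ∫ x in (0 : ℝ)..2 * Real.pi, g (groupVelocity a b x) =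
      ∫ φ in (0 : ℝ)..2 * Real.pi, g (a * Real.sin φ) := by
  have hb : b ≠ 0 := by
    rintro rfl; simp at hab; exact absurd hab (not_lt.2 (abs_nonneg a))
  have hr : |a / b| < 1 := by
    rw [abs_div]; exact (div_lt_one (abs_pos.2 hb)).2 hab
  have hrs : ∀ y : ℝ, |y| ≤ 1 → |a / b * y| < 1 := fun y hy => by
    rw [abs_mul]
    exact (mul_le_of_le_one_right (abs_nonneg _) hy).trans_lt hr
  have habs : ∀ y, g |y| = g y := fun y => by
    rcases abs_choice y with h | h <;> rw [h]
    exact heven y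
  have hpos : ∀ φ, 0 < 1 - (a / b * Real.sin φ) ^ 2 := fun φ => by
    have := (sq_lt_one_iff_abs_lt_one _).2 (hrs _ (Real.abs_sin_le_one φ))
    linarith
  have hsqrt : ∀ φ, √(1 - (a / b * Real.sin φ) ^ 2) ≠ 0 := fun φ => (Real.sqrt_pos.2 (hpos φ)).ne'
  have hderiv : ∀ φ, HasDerivAt (fun φ => φ + Real.arcsin (a / b * Real.sin φ))
      (1 + 1 / √(1 - (a / b * Real.sin φ) ^ 2) * (a / b * Real.cos φ)) φ := fun φ => by
    have h := abs_lt.1 (hrs _ (Real.abs_sin_le_one φ))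
    exact (hasDerivAt_id φ).add (HasDerivAt.comp (h₂ := Real.arcsin) φ
      (Real.hasDerivAt_arcsin h.1.ne' h.2.ne) ((Real.hasDerivAt_sin φ).const_mul (a / b)))
  have hv : Continuous fun x => groupVelocity a b x := by
    have h0 : ∀ x : ℝ, ‖symbol a b (x : Momentum)‖ ≠ 0 := fun x => by
      simpa using symbol_ne_zero hab.ne _
    have h1 : Continuous fun x : ℝ => ‖symbol a b (x : Momentum)‖ :=
      (continuous_symbol.comp (AddCircle.continuous_mk' _)).norm
    unfold groupVelocity
    fun_prop (disch := assumption)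
  have hcd : Continuous fun φ => 1 / √(1 - (a / b * Real.sin φ) ^ 2) * (a / b * Real.cos φ) := by
    fun_prop (disch := assumption)
  have hsubst := intervalIntegral.integral_comp_mul_deriv (a := 0) (b := 2 * Real.pi)
    (g := fun x => g (groupVelocity a b x)) (fun φ _ => hderiv φ)
    (continuous_const.add hcd).continuousOn (hg.comp hv)
  -- The extra Jacobian term is a function of sin φ times cos φ, so it integrates to 0 between
  -- points with equal sine.
  have hexact := intervalIntegral.integral_comp_mul_deriv'' (a := 0) (b := 2 * Real.pi)
    (f := Real.sin) (f' := Real.cos)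
    (g := fun y => g (a * y) * (1 / √(1 - (a / b * y) ^ 2) * (a / b)))
    Real.continuous_sin.continuousOn (fun φ _ => (Real.hasDerivAt_sin φ).hasDerivWithinAt)
    Real.continuous_cos.continuousOn (by
      refine (hg.comp (continuous_const_mul a)).continuousOn.mul
        ((continuousOn_const.div (by fun_prop) ?_).mul continuousOn_const)
      rintro _ ⟨φ, -, rfl⟩
      exact hsqrt φ)
  simp only [Real.sin_zero, Real.sin_two_pi, intervalIntegral.integral_same, mul_zero,
    Real.arcsin_zero, add_zero] at hsubst hexact
  rw [← hsubst]
  have hsplit : ∀ φ, ((fun x => g (groupVelocity a b x)) ∘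
      fun φ => φ + Real.arcsin (a / b * Real.sin φ)) φ *
        (1 + 1 / √(1 - (a / b * Real.sin φ) ^ 2) * (a / b * Real.cos φ)) =
      g (a * Real.sin φ) + ((fun y => g (a * y) * (1 / √(1 - (a / b * y) ^ 2) * (a / b))) ∘
        Real.sin) φ * Real.cos φ := fun φ => by
    simp only [Function.comp_apply]
    rw [← habs (groupVelocity _ _ _), abs_groupVelocity_add_arcsin hab, habs]
    ring
  simp only [hsplit]
  rw [intervalIntegral.integral_add, hexact, add_zero]
  · exact (by fun_prop : Continuous fun φ => g (a * Real.sin φ)).intervalIntegrable _ _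
  · refine Continuous.intervalIntegrable ?_ _ _
    simp only [Function.comp_def]
    fun_prop (disch := assumption)

theorem intervalIntegral_comp_sin_eq_two_mul {g : ℝ → ℝ} (hg : Continuous g)
    (heven : ∀ y, g (-y) = g y) :
    ∫ φ in (0 : ℝ)..2 * Real.pi, g (Real.sin φ) =
      2 * ∫ φ in (-(Real.pi / 2))..(Real.pi / 2), g (Real.sin φ) := by
  have hc : Continuous fun φ => g (Real.sin φ) := by fun_prop
  have hp : Function.Periodic (fun φ => g (Real.sin φ)) (2 * Real.pi) := fun φ => by simp
  have h1 := hp.intervalIntegral_add_eq 0 (-(Real.pi / 2))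
  have h2 : ∫ φ in (-(Real.pi / 2))..(Real.pi / 2), g (Real.sin (φ + Real.pi)) =
      ∫ φ in (-(Real.pi / 2) + Real.pi)..(Real.pi / 2 + Real.pi), g (Real.sin φ) :=
    intervalIntegral.integral_comp_add_right (fun φ => g (Real.sin φ)) Real.pi
  simp only [Real.sin_add_pi, heven] at h2
  rw [zero_add] at h1
  rw [h1, ← intervalIntegral.integral_add_adjacent_intervals (b := Real.pi / 2)
    (hc.intervalIntegrable _ _) (hc.intervalIntegrable _ _)]
  rw [h2, show -(Real.pi / 2) + Real.pi = Real.pi / 2 by ring,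
    show Real.pi / 2 + Real.pi = -(Real.pi / 2) + 2 * Real.pi by ring,
    ← two_mul]

end QuantumWalk

/-! ### The arcsine law -/

section Arcsine

theorem image_mul_sin_Ioo {r : ℝ} (hr : 0 < r) :
    (fun φ => r * Real.sin φ) '' Ioo (-(Real.pi / 2)) (Real.pi / 2) = Ioo (-r) r := by
  have h : Real.sin '' Ioo (-(Real.pi / 2)) (Real.pi / 2) = Ioo (-1) 1 := by
    exact Real.sinPartialHomeomorph.image_source_eq_target
  rw [← Set.image_image (fun y => r * y), h, Set.image_mul_left_Ioo hr]
  simp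

theorem injOn_mul_sin {r : ℝ} (hr : 0 < r) :
    InjOn (fun φ => r * Real.sin φ) (Ioo (-(Real.pi / 2)) (Real.pi / 2)) := fun _ hx _ hy h =>
  Real.injOn_sin (Ioo_subset_Icc_self hx) (Ioo_subset_Icc_self hy) (mul_left_cancel₀ hr.ne' h)

/-- Under y = 2|c| sin φ the root √(4c² - y²) equals 2|c| cos φ and cancels the Jacobian, leaving
the uniform density 1/π. -/
theorem abs_deriv_smul_arcsineDensity {E : Type*} [AddCommGroup E] [Module ℝ E] {c : ℝ}
    (hc : c ≠ 0) (g : ℝ → E) {φ : ℝ} (hφ : φ ∈ Ioo (-(Real.pi / 2)) (Real.pi / 2)) :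
    |2 * |c| * Real.cos φ| • (arcsineDensity c (2 * |c| * Real.sin φ) •
      g (2 * |c| * Real.sin φ)) = Real.pi⁻¹ • g (2 * |c| * Real.sin φ) := by
  have hcos : 0 < Real.cos φ := Real.cos_pos_of_mem_Ioo hφ
  have hr : 0 < 2 * |c| := by positivity
  have hpos : 0 < 2 * |c| * Real.cos φ := by positivity
  have hmem : 2 * |c| * Real.sin φ ∈ Ioo (-2 * |c|) (2 * |c|) := by
    rw [neg_mul, ← image_mul_sin_Ioo hr]
    exact mem_image_of_mem _ hφ
  have hsq : √(4 * c ^ 2 - (2 * |c| * Real.sin φ) ^ 2) = 2 * |c| * Real.cos φ := by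
    rw [← Real.sqrt_sq hpos.le]
    congr 1
    rw [mul_pow, mul_pow, mul_pow, mul_pow, sq_abs]
    linear_combination (-4 * c ^ 2) * Real.sin_sq_add_cos_sq φ
  rw [arcsineDensity, indicator_of_mem hmem, hsq, abs_of_pos hpos, smul_smul]
  congr 1
  have := Real.pi_pos
  field_simp

variable {E : Type*} [NormedAddCommGroup E] [NormedSpace ℝ E]

theorem hasDerivWithinAt_mul_sin (r : ℝ) (s : Set ℝ) (φ : ℝ) :
    HasDerivWithinAt (fun φ => r * Real.sin φ) (r * Real.cos φ) s φ :=
  ((Real.hasDerivAt_sin φ).const_mul r).hasDerivWithinAt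

theorem support_arcsineDensity_smul_subset (c : ℝ) (g : ℝ → E) :
    Function.support (fun y => arcsineDensity c y • g y) ⊆ Ioo (-(2 * |c|)) (2 * |c|) := by
  intro y hy
  by_contra h
  rw [← neg_mul] at h
  exact hy (by simp only [arcsineDensity, indicator_of_notMem h, zero_smul])

theorem integral_arcsineDensity_smul {c : ℝ} (hc : c ≠ 0) (g : ℝ → E) :
    ∫ y, arcsineDensity c y • g y =
      Real.pi⁻¹ • ∫ φ in (-(Real.pi / 2))..(Real.pi / 2), g (2 * |c| * Real.sin φ) := by
  have hr : 0 < 2 * |c| := by positivity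
  rw [← setIntegral_eq_integral_of_forall_compl_eq_zero (s := Ioo (-(2 * |c|)) (2 * |c|))
      (fun y hy => Function.notMem_support.1 fun h => hy (support_arcsineDensity_smul_subset c g h)),
    ← image_mul_sin_Ioo hr,
    integral_image_eq_integral_abs_deriv_smul measurableSet_Ioo
      (fun φ _ => hasDerivWithinAt_mul_sin _ _ φ) (injOn_mul_sin hr),
    setIntegral_congr_fun measurableSet_Ioo (fun φ hφ => abs_deriv_smul_arcsineDensity hc g hφ),
    integral_smul, intervalIntegral.integral_of_le (by linarith [Real.pi_pos]),
    integral_Ioc_eq_integral_Ioo]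

theorem integrable_arcsineDensity {c : ℝ} (hc : c ≠ 0) : Integrable (arcsineDensity c) := by
  have hr : 0 < 2 * |c| := by positivity
  have h : IntegrableOn (fun y => arcsineDensity c y • (1 : ℝ)) (Ioo (-(2 * |c|)) (2 * |c|)) := by
    rw [← image_mul_sin_Ioo hr, integrableOn_image_iff_integrableOn_abs_deriv_smul measurableSet_Ioo
      (fun φ _ => hasDerivWithinAt_mul_sin _ _ φ) (injOn_mul_sin hr),
      integrableOn_congr_fun (fun φ hφ => abs_deriv_smul_arcsineDensity hc (fun _ => (1 : ℝ)) hφ)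
        measurableSet_Ioo]
    exact integrableOn_const (by simp)
  have h2 := (integrableOn_iff_integrable_of_support_subset
    (support_arcsineDensity_smul_subset c fun _ => (1 : ℝ))).1 h
  simpa using h2

theorem integral_arcsineDensity {c : ℝ} (hc : c ≠ 0) : ∫ y, arcsineDensity c y = 1 := by
  have h := integral_arcsineDensity_smul hc (fun _ => (1 : ℝ))
  have := Real.pi_pos
  simp only [smul_eq_mul, mul_one, intervalIntegral.integral_const] at h
  rw [h]
  field_simp
  ring

theorem arcsineDensity_nonneg (c y : ℝ) : 0 ≤ arcsineDensity c y :=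
  indicator_nonneg (fun _ _ => by have := Real.pi_pos; positivity) y

/-- The arcsine law on `(-2|c|, 2|c|)`. -/
noncomputable def arcsineMeasure (c : ℝ) : Measure ℝ :=
  volume.withDensity fun y => ENNReal.ofReal (arcsineDensity c y)

theorem measurable_arcsineDensity (c : ℝ) : Measurable (arcsineDensity c) := by
  unfold arcsineDensity
  exact Measurable.indicator (by fun_prop) measurableSet_Ioo

theorem isProbabilityMeasure_arcsineMeasure {c : ℝ} (hc : c ≠ 0) :
    IsProbabilityMeasure (arcsineMeasure c) := by
  refine ⟨?_⟩
  rw [arcsineMeasure, withDensity_apply _ MeasurableSet.univ, Measure.restrict_univ,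
    ← ofReal_integral_eq_lintegral_ofReal (integrable_arcsineDensity hc)
      (ae_of_all _ (arcsineDensity_nonneg c)), integral_arcsineDensity hc, ENNReal.ofReal_one]

theorem integral_arcsineMeasure {c : ℝ} (hc : c ≠ 0) (g : ℝ → E) :
    ∫ y, g y ∂arcsineMeasure c =
      Real.pi⁻¹ • ∫ φ in (-(Real.pi / 2))..(Real.pi / 2), g (2 * |c| * Real.sin φ) := by
  rw [arcsineMeasure, integral_withDensity_eq_integral_toReal_smul
    (measurable_arcsineDensity c).ennreal_ofReal (ae_of_all _ fun _ => ENNReal.ofReal_lt_top),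
    ← integral_arcsineDensity_smul hc]
  simp only [ENNReal.toReal_ofReal (arcsineDensity_nonneg c _)]

theorem real_arcsineMeasure_Iic {c : ℝ} (hc : c ≠ 0) (x : ℝ) :
    (arcsineMeasure c).real (Iic x) = ∫ y in Iic x, arcsineDensity c y := by
  rw [Measure.real, arcsineMeasure, withDensity_apply _ measurableSet_Iic,
    ← ofReal_integral_eq_lintegral_ofReal (integrable_arcsineDensity hc).integrableOn
      (ae_of_all _ (arcsineDensity_nonneg c)),
    ENNReal.toReal_ofReal (integral_nonneg (arcsineDensity_nonneg c))]

/-- The sine part vanishes by oddness; the cosine part is spread over a full period to match the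
limit of the overlaps. -/
theorem charFun_arcsineMeasure {c : ℝ} (hc : c ≠ 0) (s : ℝ) :
    charFun (arcsineMeasure c) s =
      ((2 * Real.pi)⁻¹ * ∫ φ in (0 : ℝ)..2 * Real.pi, Real.cos (2 * s * (c * Real.sin φ)) : ℝ) := by
  have habs : ∀ φ, Real.cos (2 * s * (c * Real.sin φ)) = Real.cos (2 * s * |c| * Real.sin φ) := by
    intro φ
    rcases abs_choice c with h | h <;> rw [h]
    · ring_nf
    · rw [← Real.cos_neg]; ring_nf
  have hsin : ∫ φ in (-(Real.pi / 2))..(Real.pi / 2), Real.sin (2 * s * |c| * Real.sin φ) = 0 := by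
    have h := intervalIntegral.integral_comp_neg (a := -(Real.pi / 2)) (b := Real.pi / 2)
      (fun φ => Real.sin (2 * s * |c| * Real.sin φ))
    simp only [Real.sin_neg, mul_neg, intervalIntegral.integral_neg, neg_neg] at h
    linarith
  simp only [habs]
  rw [QuantumWalk.intervalIntegral_comp_sin_eq_two_mul (g := fun y => Real.cos (2 * s * |c| * y))
    (by fun_prop) (by simp), charFun_apply_real, integral_arcsineMeasure hc]
  have hexp : ∀ φ : ℝ, Complex.exp (s * (2 * |c| * Real.sin φ : ℝ) * Complex.I) =
      (Real.cos (2 * s * |c| * Real.sin φ) : ℂ) +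
        (Real.sin (2 * s * |c| * Real.sin φ) : ℂ) * Complex.I := fun φ => by
    rw [show (s : ℂ) * (2 * |c| * Real.sin φ : ℝ) = (2 * s * |c| * Real.sin φ : ℝ) by
      push_cast; ring, Complex.exp_mul_I]
    push_cast; rfl
  simp only [hexp]
  rw [intervalIntegral.integral_add (Continuous.intervalIntegrable (by fun_prop) _ _)
    (Continuous.intervalIntegrable (by fun_prop) _ _), intervalIntegral.integral_mul_const,
    intervalIntegral.integral_ofReal, intervalIntegral.integral_ofReal, hsin, Complex.real_smul]
  have : (Real.pi : ℂ) ≠ 0 := by exact_mod_cast Real.pi_ne_zero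
  push_cast
  field_simp
  ring

end Arcsine

/-! ### Convergence in distribution -/

open QuantumWalk in
theorem charFun_map_div_eq_integral_overlap {γ : Fin 2 → ℝ} {ψ : ℝ → ℤ → ℂ}
    (hψ : IsQuantumWalk γ ψ) (hγ : |γ 0| ≠ |γ 1|) {Ω : Type*} [MeasurableSpace Ω]
    {P : Measure Ω} [IsProbabilityMeasure P] {t : ℝ} (ht : 0 ≤ t) {Y : Ω → ℤ} (hY : Measurable Y)
    (hlaw : ∀ x : ℤ, P.real {ω | Y ω = x} = ‖ψ t x‖ ^ 2) (s : ℝ) :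
    charFun (P.map fun ω => (Y ω : ℝ) / t) s =
      ∫ θ, overlap (γ 0) (γ 1) t (s / t) θ ∂AddCircle.haarAddCircle := by
  have hm : Measurable fun x : ℤ => (x : ℝ) / t := measurable_of_countable _
  have hcomp : P.map (fun ω => (Y ω : ℝ) / t) = (P.map Y).map fun x : ℤ => (x : ℝ) / t :=
    (Measure.map_map hm hY).symm
  have : IsProbabilityMeasure (P.map Y) := Measure.isProbabilityMeasure_map hY.aemeasurable
  rw [charFun_apply_real, hcomp, integral_map hm.aemeasurable (by fun_prop), integral_countable,
    ← (hψ.hasSum_norm_sq_mul_exp hγ ht (s / t)).tsum_eq]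
  · refine tsum_congr fun x => ?_
    rw [map_measureReal_apply hY (measurableSet_singleton x),
      show Y ⁻¹' {x} = {ω | Y ω = x} from rfl, hlaw, Complex.real_smul]
    push_cast
    rw [div_mul_eq_mul_div, mul_div_assoc]
  · refine Integrable.of_bound (C := 1) (measurable_of_countable _).aestronglyMeasurable
      (ae_of_all _ fun x => ?_)
    rw [← Complex.ofReal_mul, Complex.norm_exp_ofReal_mul_I]

open QuantumWalk in
theorem charFun_arcsineMeasure_eq_integral_groupVelocity {a b c : ℝ} (hc : c ≠ 0)
    (hab : |a| ≠ |b|) (habc : |c| = min |a| |b|) (s : ℝ) :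
    charFun (arcsineMeasure c) s = ((2 * Real.pi)⁻¹ * ∫ x in (0 : ℝ)..2 * Real.pi,
      Real.cos (2 * s * groupVelocity a b x) : ℝ) := by
  have main : ∀ p q : ℝ, |p| < |q| → |c| = |p| → charFun (arcsineMeasure c) s =
      ((2 * Real.pi)⁻¹ * ∫ x in (0 : ℝ)..2 * Real.pi,
        Real.cos (2 * s * groupVelocity p q x) : ℝ) := fun p q hpq hcp => by
    rw [intervalIntegral_comp_groupVelocity hpq (g := fun y => Real.cos (2 * s * y)) (by fun_prop)
      (by simp), charFun_arcsineMeasure hc]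
    have : ∀ φ, Real.cos (2 * s * (c * Real.sin φ)) = Real.cos (2 * s * (p * Real.sin φ)) := by
      intro φ
      rcases abs_eq_abs.1 hcp with h | h <;> rw [h]
      rw [← Real.cos_neg]
      ring_nf
    simp only [this]
  rcases hab.lt_or_gt with h | h
  · exact main a b h (by rw [habc, min_eq_left h.le])
  · simp only [groupVelocity_comm a b]
    exact main b a h (by rw [habc, min_eq_right h.le])

theorem theorem1 (γ : Fin 2 → ℝ) (hγ₀ : γ 0 ≠ 0) (hγ₁ : γ 1 ≠ 0) (hγ : |γ 0| ≠ |γ 1|)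
    (ξ : Fin 2) (hξ : |γ ξ| = min |γ 0| |γ 1|)
    (ψ : ℝ → ℤ → ℂ) (hψ : IsQuantumWalk γ ψ)
    {Ω : Type*} [MeasurableSpace Ω] (P : Measure Ω) [IsProbabilityMeasure P]
    (X : ℝ → Ω → ℤ) (hX : ∀ t : ℝ, 0 ≤ t → Measurable (X t))
    (hlaw : ∀ t : ℝ, 0 ≤ t → ∀ x : ℤ, P.real {ω | X t ω = x} = ‖ψ t x‖ ^ 2) :
    (Integrable (arcsineDensity (γ ξ)) ∧ ∫ y, arcsineDensity (γ ξ) y = 1) ∧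
      ∀ x : ℝ, Tendsto (fun t : ℝ => P.real {ω | (X t ω : ℝ) / t ≤ x}) atTop
        (𝓝 (∫ y in Iic x, arcsineDensity (γ ξ) y)) := by
  have hc : γ ξ ≠ 0 := by
    rw [← abs_pos, hξ]
    exact lt_min (abs_pos.2 hγ₀) (abs_pos.2 hγ₁)
  refine ⟨⟨integrable_arcsineDensity hc, integral_arcsineDensity hc⟩, fun x => ?_⟩
  have := isProbabilityMeasure_arcsineMeasure hc
  have hm : ∀ t : ℝ, 0 ≤ t → Measurable fun ω => (X t ω : ℝ) / t := fun t ht =>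
    (measurable_of_countable fun x : ℤ => (x : ℝ) / t).comp (hX t ht)
  -- Using |t| gives a probability measure for every real t, though X is measurable only at
  -- nonnegative times; nothing changes for t ≥ 0.
  let μ : ℝ → ProbabilityMeasure ℝ := fun t => ⟨P.map fun ω => (X |t| ω : ℝ) / |t|,
    Measure.isProbabilityMeasure_map (hm |t| (abs_nonneg t)).aemeasurable⟩
  have hconv : Tendsto μ atTop (𝓝 ⟨arcsineMeasure (γ ξ), this⟩) := by
    -- Lévy's continuity theorem is applied along sequences of times tending to infinity.
    refine tendsto_of_seq_tendsto fun u hu => ?_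
    refine ProbabilityMeasure.tendsto_of_tendsto_charFun fun s => ?_
    have h := (QuantumWalk.tendsto_integral_overlap hγ s).comp (tendsto_abs_atTop_atTop.comp hu)
    rw [← charFun_arcsineMeasure_eq_integral_groupVelocity hc hγ hξ] at h
    refine h.congr fun n => ?_
    exact (charFun_map_div_eq_integral_overlap hψ hγ (abs_nonneg (u n)) (hX _ (abs_nonneg _))
      (hlaw _ (abs_nonneg _)) s).symm
  -- The limit law has no atoms, so weak convergence gives convergence of the distribution function
  -- at every x.
  have hnull : arcsineMeasure (γ ξ) (frontier (Iic x)) = 0 := by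
    rw [frontier_Iic]
    exact withDensity_absolutelyContinuous _ _ (measure_singleton x)
  have hcdf := (ENNReal.tendsto_toReal (measure_ne_top (arcsineMeasure (γ ξ)) _)).comp
    (ProbabilityMeasure.tendsto_measure_of_null_frontier_of_tendsto' hconv hnull)
  rw [← real_arcsineMeasure_Iic hc]
  refine hcdf.congr' ?_
  filter_upwards [eventually_ge_atTop 0] with t ht
  change (P.map fun ω => (X |t| ω : ℝ) / |t|).real (Iic x) = _
  rw [abs_of_nonneg ht, map_measureReal_apply (hm t ht) measurableSet_Iic]
  rfl
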